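/- Logarithms are natural. For a probability distribution $p$ on a product $\mathcal X\times\mathcal Y$ of finite sets and $\alpha\in(0,\infty)$, $\alpha\ne 1$, let $$H^A_\alpha(X|Y)_p=\frac{\alpha}{1-\alpha}\log\sum_y p(y)\Big(\sum_x p(x|y)^\alpha\Big)^{1/\alpha}$$ be the Arimoto conditional Rényi entropy, and let $H^A_1(X|Y)_p$ be the conditional Shannon entropy. For $\beta\in(0,\infty)$, $\beta\neq1$, and $t\in[0,1]$ let $h_\beta(t)=\frac1{1-\beta}\log\big(t^\beta+(1-t)^\beta\big)$ be the binary Rényi entropy, let $h_1$ be the binary Shannon entropy, and let $h_\beta^{-1}:[0,\log 2]\to[0,\tfrac12]$ be the inverse of $h_\beta|_{[0,1/2]}$. Write $a\ast b=a(1-b)+(1-a)b$. **Theorem.** Let $Y_1,Y_2$ take values in arbitrary finite sets, let $X_1,X_2$ take values in $\{0,1\}$ with addition modulo 2, and let the pairs $(X_1,Y_1)\sim p_1$ and $(X_2,Y_2)\sim p_2$ be independent. If $\alpha\in(0,\frac13]\cup[\frac12,\infty)$, then $$H^A_\alpha(X_2|X_1+X_2,Y_1Y_2)\le H^A_\alpha(X_1|Y_1)+H^A_\alpha(X_2|Y_2)-h_{1/\alpha}\Big(h_{1/\alpha}^{-1}\big(H^A_\alpha(X_1|Y_1)\big)\ast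 h_{1/\alpha}^{-1}\big(H^A_\alpha(X_2|Y_2)\big)\Big).$$ If $\alpha\in[\frac13,\frac12]$, the same holds with $\le$ replaced by $\ge$; in particular equality holds for $\alpha\in\{\frac13,\frac12\}$. The bounds are tight: for every $\alpha\in(0,\infty)$ equality holds whenever $p_1$ and $p_2$ are the input-output distributions of binary symmetric channels with uniform input and arbitrary crossover probabilities in $[0,1]$; and for all $H_1,H_2\in[0,\log2]$ there are such channels, with crossover probabilities in $[0,\frac12]$, for which $H^A_\alpha(X_i|Y_i)=H_i$ ($i=1,2$). -/

import Mathlib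

namespace RenyiCombining

noncomputable section

/-- The marginal `p(y) = ∑ₓ p(x, y)` of a joint distribution on `X × Y`. -/
def marginal {X Y : Type*} [Fintype X] (p : X × Y → ℝ) (y : Y) : ℝ :=
  ∑ x, p (x, y)

/-- The conditional probability `p(x | y) = p(x, y) / p(y)`. It is only ever used with weight
`p(y)`, so its value where `p(y) = 0` plays no role. -/
def condProb {X Y : Type*} [Fintype X] (p : X × Y → ℝ) (x : X) (y : Y) : ℝ :=
  p (x, y) / marginal p y

/-- The Arimoto conditional Rényi entropy `H^A_α(X|Y)_p` (natural logarithm). At `α = 1` it is the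
limiting value, the conditional Shannon entropy. -/
def arimotoEntropy {X Y : Type*} [Fintype X] [Fintype Y] (α : ℝ) (p : X × Y → ℝ) : ℝ :=
  if α = 1 then ∑ y, marginal p y * ∑ x, Real.negMulLog (condProb p x y)
  else α / (1 - α) * Real.log (∑ y, marginal p y * (∑ x, condProb p x y ^ α) ^ (1 / α))

/-- The binary Rényi entropy `h_β(t)`; at `β = 1` it is the binary Shannon entropy. -/
def binRenyi (β t : ℝ) : ℝ :=
  if β = 1 then Real.binEntropy t
  else 1 / (1 - β) * Real.log (t ^ β + (1 - t) ^ β)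

/-- The inverse `h_β⁻¹` of the binary Rényi entropy restricted to `[0, 1/2]`. -/
def binRenyiInv (β v : ℝ) : ℝ :=
  Function.invFunOn (binRenyi β) (Set.Icc 0 (1 / 2)) v

/-- The binary convolution `a ∗ b = a (1 - b) + (1 - a) b`. -/
def binConv (a b : ℝ) : ℝ := a * (1 - b) + (1 - a) * b

/-- The joint distribution of `X₂` and `(X₁ + X₂, Y₁, Y₂)`, where `(X₁, Y₁) ∼ p₁` and
`(X₂, Y₂) ∼ p₂` are independent and `X₁, X₂` are bits: its value at `(x₂, (z, y₁, y₂))` is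
`p₁(z ⊕ x₂, y₁) p₂(x₂, y₂)`. -/
def variableNode {Y₁ Y₂ : Type*} (p₁ : ZMod 2 × Y₁ → ℝ) (p₂ : ZMod 2 × Y₂ → ℝ) :
    ZMod 2 × (ZMod 2 × Y₁ × Y₂) → ℝ :=
  fun w => p₁ (w.2.1 + w.1, w.2.2.1) * p₂ (w.1, w.2.2.2)

/-- The joint distribution of input and output of the binary symmetric channel with crossover
probability `ε` and uniform input. -/
def bsc (ε : ℝ) : ZMod 2 × ZMod 2 → ℝ :=
  fun w => 1 / 2 * (if w.2 = w.1 then 1 - ε else ε)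

/-- The expression `H₁ + H₂ - h_{1/α}(h_{1/α}⁻¹(H₁) ∗ h_{1/α}⁻¹(H₂))`. -/
def bscBound (α H₁ H₂ : ℝ) : ℝ :=
  H₁ + H₂ - binRenyi (1 / α) (binConv (binRenyiInv (1 / α) H₁) (binRenyiInv (1 / α) H₂))

theorem variableNode_mem_stdSimplex {Y₁ Y₂ : Type*} [Fintype Y₁] [Fintype Y₂]
    {p₁ : ZMod 2 × Y₁ → ℝ} {p₂ : ZMod 2 × Y₂ → ℝ}
    (h₁ : p₁ ∈ stdSimplex ℝ (ZMod 2 × Y₁)) (h₂ : p₂ ∈ stdSimplex ℝ (ZMod 2 × Y₂)) :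
    variableNode p₁ p₂ ∈ stdSimplex ℝ (ZMod 2 × (ZMod 2 × Y₁ × Y₂)) := by
  refine ⟨fun w => mul_nonneg (h₁.1 _) (h₂.1 _), ?_⟩
  have key : ∀ x₂ : ZMod 2, ∑ w : ZMod 2 × Y₁ × Y₂, variableNode p₁ p₂ (x₂, w)
      = ∑ y₂, p₂ (x₂, y₂) := by
    intro x₂
    calc ∑ w : ZMod 2 × Y₁ × Y₂, variableNode p₁ p₂ (x₂, w)
        = ∑ z : ZMod 2, ∑ y₁, ∑ y₂, p₁ (z + x₂, y₁) * p₂ (x₂, y₂) := by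
          simp only [Fintype.sum_prod_type, variableNode]
      _ = (∑ z : ZMod 2, ∑ y₁, p₁ (z + x₂, y₁)) * ∑ y₂, p₂ (x₂, y₂) := by
          simp only [Finset.sum_mul, ← Finset.mul_sum]
      _ = (∑ z : ZMod 2, ∑ y₁, p₁ (z, y₁)) * ∑ y₂, p₂ (x₂, y₂) := by
          rw [← Equiv.sum_comp (Equiv.addRight x₂) (fun z => ∑ y₁, p₁ (z, y₁))]
          rfl
      _ = ∑ y₂, p₂ (x₂, y₂) := by
          rw [← Fintype.sum_prod_type, h₁.2, one_mul]
  rw [Fintype.sum_prod_type]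
  simp only [key]
  rw [← Fintype.sum_prod_type, h₂.2]

theorem bsc_mem_stdSimplex {ε : ℝ} (h : ε ∈ Set.Icc (0 : ℝ) 1) :
    bsc ε ∈ stdSimplex ℝ (ZMod 2 × ZMod 2) := by
  refine ⟨fun w => ?_, ?_⟩
  · have h1 := h.1
    have h2 := h.2
    unfold bsc
    split_ifs <;> linarith
  · rw [Fintype.sum_prod_type]
    have e : ∀ f : ZMod 2 → ℝ, ∑ i, f i = f 0 + f 1 := fun f => Fin.sum_univ_two f
    simp only [e, bsc]
    simp
    ring

end

end RenyiCombining

open RenyiCombining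

/-!
Put `β = 1 / α` and describe a bit with `P(X = 0) = (1 + x) / 2` by its bias `x`; under this
parametrization binary convolution is multiplication of biases. For every `y` tilt `p(· | y)` to the
distribution proportional to `p(·, y) ^ α`, with bias `ξ(y)`, and let `N(y)` be the `ℓ^α` norm of
`p(·, y)`, `A = ∑ N(y)` and `q = N / A`. With `Γ(x) = ((1 + x) / 2) ^ β + ((1 - x) / 2) ^ β` one has
`p(y) = N(y) Γ(ξ(y))`, so the `q`-average of `Γ(ξ)` is `1 / A`, which determines the Arimoto entropy
`α / (1 - α) log A`. For the pair at the variable node the corresponding sum of norms is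
`∑ N₁ N₂ Γ(ξ₁ ξ₂)` (`arimotoEntropy_variableNode`). For `α = 1` the same holds with `Γ` replaced by
the binary entropy, by the chain rule.

The theorem therefore compares the average of `Γ(ξ₁ ξ₂)` with `Γ(m₁ m₂)`, where `Γ(mᵢ)` is the
average of `Γ(ξᵢ)`. This is Jensen's inequality, applied in each variable, for `Γ(x) ↦ Γ(x y)`
(`scaled_jensen`). This map is concave or convex as soon as the elasticity `x Γ''(x) / Γ'(x)` is
monotone. At `x = tanh s` the elasticity is `(γ / 2) (1 + sinh ((2 - γ) s) / sinh (γ s))` with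
`γ = β - 1` (`power_elasticity`), or `sinh (2 s) / (2 s)` if `β = 1`; it increases unless
`2 ≤ β ≤ 3`, where it decreases. Since `Γ` itself increases for `β > 1` and decreases for `β < 1`,
this gives the ranges of `α` in the theorem.

For a binary symmetric channel `Γ(ξ)` is constant, so Jensen's inequality is an equality.
-/

namespace RenyiCombining

/-! ### Quotients of hyperbolic sines -/

/-- For `0 ≤ a ≤ b` the function `s ↦ sinh (a s) / sinh (b s)` has a nonpositive derivative. -/
theorem mul_cosh_mul_sinh_le {a b s : ℝ} (ha : 0 ≤ a) (hab : a ≤ b) (hs : 0 ≤ s) :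
    a * Real.cosh (a * s) * Real.sinh (b * s) ≤ b * Real.sinh (a * s) * Real.cosh (b * s) := by
  have hd : ∀ t : ℝ, HasDerivAt
      (fun t => b * Real.sinh (a * t) * Real.cosh (b * t) -
        a * Real.cosh (a * t) * Real.sinh (b * t))
      ((b ^ 2 - a ^ 2) * (Real.sinh (a * t) * Real.sinh (b * t))) t := by
    intro t
    have h1 : HasDerivAt (fun t : ℝ => a * t) a t := by
      simpa using (hasDerivAt_id t).const_mul a
    have h2 : HasDerivAt (fun t : ℝ => b * t) b t := by
      simpa using (hasDerivAt_id t).const_mul b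
    refine (((h1.sinh.const_mul b).mul h2.cosh).sub
      ((h1.cosh.const_mul a).mul h2.sinh)).congr_deriv ?_
    ring
  have hmono : MonotoneOn (fun t => b * Real.sinh (a * t) * Real.cosh (b * t) -
        a * Real.cosh (a * t) * Real.sinh (b * t)) (Set.Ici 0) := by
    refine monotoneOn_of_deriv_nonneg (convex_Ici 0)
      (fun t _ => (hd t).continuousAt.continuousWithinAt)
      (fun t _ => (hd t).differentiableAt.differentiableWithinAt) fun t ht => ?_
    rw [interior_Ici, Set.mem_Ioi] at ht
    rw [(hd t).deriv]
    have h1 : 0 ≤ Real.sinh (a * t) := Real.sinh_nonneg_iff.2 (by positivity)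
    have h2 : 0 ≤ Real.sinh (b * t) :=
      Real.sinh_nonneg_iff.2 (mul_nonneg (ha.trans hab) ht.le)
    have h3 : 0 ≤ b ^ 2 - a ^ 2 := by nlinarith
    positivity
  have h := hmono (Set.mem_Ici.2 le_rfl) (Set.mem_Ici.2 hs) hs
  simp only [mul_zero, Real.sinh_zero, zero_mul, sub_zero] at h
  linarith

theorem sinh_mul_div_sinh_mul_antitoneOn {a b : ℝ} (ha : 0 ≤ a) (hab : a ≤ b) (hb : 0 < b) :
    AntitoneOn (fun s => Real.sinh (a * s) / Real.sinh (b * s)) (Set.Ioi 0) := by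
  have hpos : ∀ t : ℝ, 0 < t → 0 < Real.sinh (b * t) := fun t ht =>
    Real.sinh_pos_iff.2 (mul_pos hb ht)
  have hd : ∀ t : ℝ, 0 < t → HasDerivAt (fun s => Real.sinh (a * s) / Real.sinh (b * s))
      ((a * Real.cosh (a * t) * Real.sinh (b * t) - b * Real.sinh (a * t) * Real.cosh (b * t))
        / Real.sinh (b * t) ^ 2) t := by
    intro t ht
    have h1 : HasDerivAt (fun t : ℝ => a * t) a t := by
      simpa using (hasDerivAt_id t).const_mul a
    have h2 : HasDerivAt (fun t : ℝ => b * t) b t := by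
      simpa using (hasDerivAt_id t).const_mul b
    refine (h1.sinh.div h2.sinh (hpos t ht).ne').congr_deriv ?_
    ring
  refine antitoneOn_of_deriv_nonpos (convex_Ioi 0)
    (fun t ht => (hd t ht).continuousAt.continuousWithinAt) ?_ ?_
  · rw [interior_Ioi]
    exact fun t ht => (hd t ht).differentiableAt.differentiableWithinAt
  · rw [interior_Ioi]
    intro t ht
    rw [(hd t ht).deriv]
    exact div_nonpos_of_nonpos_of_nonneg
      (sub_nonpos.2 (mul_cosh_mul_sinh_le ha hab (le_of_lt ht))) (sq_nonneg _)

theorem sinh_mul_div_sinh_mul_monotoneOn {a b : ℝ} (hab : b ≤ a) (hb : 0 < b) :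
    MonotoneOn (fun s => Real.sinh (a * s) / Real.sinh (b * s)) (Set.Ioi 0) := by
  intro s hs t ht hst
  have h := sinh_mul_div_sinh_mul_antitoneOn hb.le hab (hb.trans_le hab) hs ht hst
  have hpos : ∀ c t : ℝ, 0 < c → 0 < t → 0 < Real.sinh (c * t) := fun c t hc ht =>
    Real.sinh_pos_iff.2 (mul_pos hc ht)
  have ha := hb.trans_le hab
  have h1 : 0 < Real.sinh (b * t) / Real.sinh (a * t) :=
    div_pos (hpos _ _ hb ht) (hpos _ _ ha ht)
  simpa only [inv_div] using inv_anti₀ h1 h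

/-- The limiting case `b → 0` of the monotonicity of `sinh (a s) / sinh (b s)`. -/
theorem sinh_div_self_monotoneOn :
    MonotoneOn (fun s => Real.sinh s / s) (Set.Ioi 0) := by
  have hd : ∀ t : ℝ, 0 < t → HasDerivAt (fun s => Real.sinh s / s)
      ((Real.cosh t * t - Real.sinh t * 1) / t ^ 2) t := fun t ht =>
    (Real.hasDerivAt_sinh t).div (hasDerivAt_id t) ht.ne'
  have hle : ∀ t : ℝ, 0 ≤ t → Real.sinh t ≤ Real.cosh t * t := by
    intro t ht
    have hd : ∀ t : ℝ, HasDerivAt (fun t => Real.cosh t * t - Real.sinh t)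
        (Real.sinh t * t) t := by
      intro t
      refine (((Real.hasDerivAt_cosh t).mul (hasDerivAt_id t)).sub
        (Real.hasDerivAt_sinh t)).congr_deriv ?_
      simp
    have hmono : MonotoneOn (fun t => Real.cosh t * t - Real.sinh t) (Set.Ici 0) := by
      refine monotoneOn_of_deriv_nonneg (convex_Ici 0)
        (fun t _ => (hd t).continuousAt.continuousWithinAt)
        (fun t _ => (hd t).differentiableAt.differentiableWithinAt) fun t ht => ?_
      rw [interior_Ici, Set.mem_Ioi] at ht
      rw [(hd t).deriv]
      exact mul_nonneg (Real.sinh_nonneg_iff.2 ht.le) ht.le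
    have h := hmono (Set.mem_Ici.2 le_rfl) (Set.mem_Ici.2 ht) ht
    simp only [mul_zero, Real.sinh_zero, sub_zero] at h
    linarith
  refine monotoneOn_of_deriv_nonneg (convex_Ioi 0)
    (fun t ht => (hd t ht).continuousAt.continuousWithinAt) ?_ ?_
  · rw [interior_Ioi]
    exact fun t ht => (hd t ht).differentiableAt.differentiableWithinAt
  · rw [interior_Ioi]
    intro t ht
    rw [(hd t ht).deriv]
    have := hle t (le_of_lt ht)
    exact div_nonneg (by linarith) (sq_nonneg _)

/-! ### Jensen's inequality along a reparametrized scaling -/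

/-- If `L x = x D'(x) / D(x)` is monotone up to the sign `σ`, then `x ↦ D (x y) / D x` is
antitone up to the same sign: its logarithmic derivative is `(L (x y) - L x) / x`. -/
theorem scaled_ratio_antitoneOn {D D' L : ℝ → ℝ} {σ y : ℝ}
    (hD : ∀ x ∈ Set.Ioo (0 : ℝ) 1, HasDerivAt D (D' x) x)
    (hpos : ∀ x ∈ Set.Ioo (0 : ℝ) 1, 0 < D x)
    (hL : ∀ x ∈ Set.Ioo (0 : ℝ) 1, x * D' x = L x * D x)
    (hmono : MonotoneOn (fun x => σ * L x) (Set.Ioo 0 1)) (hy : y ∈ Set.Ioo (0 : ℝ) 1) :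
    AntitoneOn (fun x => σ * (D (x * y) / D x)) (Set.Ioo 0 1) := by
  have hmem : ∀ x ∈ Set.Ioo (0 : ℝ) 1, x * y ∈ Set.Ioo (0 : ℝ) 1 := fun x hx =>
    ⟨mul_pos hx.1 hy.1, mul_lt_one_of_nonneg_of_lt_one_left hx.1.le hx.2 hy.2.le⟩
  have hd : ∀ x ∈ Set.Ioo (0 : ℝ) 1, HasDerivAt (fun x => σ * (D (x * y) / D x))
      (σ * ((D' (x * y) * y * D x - D (x * y) * D' x) / D x ^ 2)) x := by
    intro x hx
    have h1 : HasDerivAt (fun x : ℝ => x * y) y x := by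
      simpa using (hasDerivAt_id x).mul_const y
    have h2 := (hD _ (hmem x hx)).comp x h1
    exact (h2.div (hD x hx) (hpos x hx).ne').const_mul σ
  refine antitoneOn_of_deriv_nonpos (convex_Ioo 0 1)
    (fun t ht => (hd t ht).continuousAt.continuousWithinAt) ?_ ?_
  · rw [interior_Ioo]
    exact fun t ht => (hd t ht).differentiableAt.differentiableWithinAt
  · rw [interior_Ioo]
    intro x hx
    rw [(hd x hx).deriv]
    have hxy : x * y ≤ x := mul_le_of_le_one_right hx.1.le hy.2.le
    have hm := hmono (hmem x hx) hx hxy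
    have hDx := hpos x hx
    have hDxy := hpos _ (hmem x hx)
    have key : x * (σ * ((D' (x * y) * y * D x - D (x * y) * D' x))) =
        (σ * L (x * y) - σ * L x) * (D (x * y) * D x) := by
      linear_combination σ * D x * hL _ (hmem x hx) - σ * D (x * y) * hL x hx
    have h1 : x * (σ * ((D' (x * y) * y * D x - D (x * y) * D' x))) ≤ 0 := by
      rw [key]
      exact mul_nonpos_of_nonpos_of_nonneg (sub_nonpos.2 hm) (mul_pos hDxy hDx).le
    have h2 : σ * ((D' (x * y) * y * D x - D (x * y) * D' x)) ≤ 0 := by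
      by_contra h
      push Not at h
      exact absurd h1 (not_le.2 (mul_pos hx.1 h))
    rw [← mul_div_assoc]
    exact div_nonpos_of_nonpos_of_nonneg h2 (sq_nonneg _)

/-- The tangent line at `m` to the curve `x ↦ (G x, G (x y))` lies on one side of the curve. -/
theorem scaled_tangent {G D D' L : ℝ → ℝ} {σ y m : ℝ}
    (hG : ContinuousOn G (Set.Icc 0 1))
    (hGD : ∀ x ∈ Set.Ioo (0 : ℝ) 1, HasDerivAt G (D x) x)
    (hD : ∀ x ∈ Set.Ioo (0 : ℝ) 1, HasDerivAt D (D' x) x)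
    (hpos : ∀ x ∈ Set.Ioo (0 : ℝ) 1, 0 < D x)
    (hL : ∀ x ∈ Set.Ioo (0 : ℝ) 1, x * D' x = L x * D x)
    (hmono : MonotoneOn (fun x => σ * L x) (Set.Ioo 0 1)) (hy : y ∈ Set.Ioo (0 : ℝ) 1)
    (hm : m ∈ Set.Ioo (0 : ℝ) 1) :
    ∃ c : ℝ, ∀ x ∈ Set.Icc (0 : ℝ) 1,
      σ * (G (x * y) - c * G x) ≤ σ * (G (m * y) - c * G m) := by
  have hmem : ∀ x ∈ Set.Ioo (0 : ℝ) 1, x * y ∈ Set.Ioo (0 : ℝ) 1 := fun x hx =>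
    ⟨mul_pos hx.1 hy.1, mul_lt_one_of_nonneg_of_lt_one_left hx.1.le hx.2 hy.2.le⟩
  have hR := scaled_ratio_antitoneOn hD hpos hL hmono hy
  -- the slope of the curve at `m`
  refine ⟨y * D (m * y) / D m, ?_⟩
  set c := y * D (m * y) / D m with hc
  have hd : ∀ x ∈ Set.Ioo (0 : ℝ) 1, HasDerivAt (fun x => σ * (G (x * y) - c * G x))
      (y * D x * (σ * (D (x * y) / D x) - σ * (D (m * y) / D m))) x := by
    intro x hx
    have h1 : HasDerivAt (fun x : ℝ => x * y) y x := by
      simpa using (hasDerivAt_id x).mul_const y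
    have h2 := (hGD _ (hmem x hx)).comp x h1
    refine ((h2.sub ((hGD x hx).const_mul c)).const_mul σ).congr_deriv ?_
    have := (hpos x hx).ne'
    rw [hc]
    field_simp
  have hcont : ContinuousOn (fun x => σ * (G (x * y) - c * G x)) (Set.Icc 0 1) := by
    have h1 : ContinuousOn (fun x => G (x * y)) (Set.Icc 0 1) :=
      hG.comp (by fun_prop) fun x hx =>
        ⟨mul_nonneg hx.1 hy.1.le, mul_le_one₀ hx.2 hy.1.le hy.2.le⟩
    exact continuousOn_const.mul (h1.sub (continuousOn_const.mul hG))
  intro x hx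
  rcases le_total x m with hxm | hxm
  · have : MonotoneOn (fun x => σ * (G (x * y) - c * G x)) (Set.Icc 0 m) := by
      refine monotoneOn_of_deriv_nonneg (convex_Icc 0 m)
        (hcont.mono (Set.Icc_subset_Icc_right hm.2.le)) ?_ ?_
      · rw [interior_Icc]
        exact fun t ht =>
          (hd t ⟨ht.1, ht.2.trans hm.2⟩).differentiableAt.differentiableWithinAt
      · rw [interior_Icc]
        intro t ht
        have ht' : t ∈ Set.Ioo (0 : ℝ) 1 := ⟨ht.1, ht.2.trans hm.2⟩
        rw [(hd t ht').deriv]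
        exact mul_nonneg (mul_pos hy.1 (hpos t ht')).le (sub_nonneg.2 (hR ht' hm ht.2.le))
    exact this ⟨hx.1, hxm⟩ ⟨hm.1.le, le_rfl⟩ hxm
  · have : AntitoneOn (fun x => σ * (G (x * y) - c * G x)) (Set.Icc m 1) := by
      refine antitoneOn_of_deriv_nonpos (convex_Icc m 1)
        (hcont.mono (Set.Icc_subset_Icc_left hm.1.le)) ?_ ?_
      · rw [interior_Icc]
        exact fun t ht =>
          (hd t ⟨hm.1.trans ht.1, ht.2⟩).differentiableAt.differentiableWithinAt
      · rw [interior_Icc]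
        intro t ht
        have ht' : t ∈ Set.Ioo (0 : ℝ) 1 := ⟨hm.1.trans ht.1, ht.2⟩
        rw [(hd t ht').deriv]
        exact mul_nonpos_of_nonneg_of_nonpos (mul_pos hy.1 (hpos t ht')).le
          (sub_nonpos.2 (hR hm ht' ht.1.le))
    exact this ⟨le_rfl, hm.2.le⟩ ⟨hxm, hx.2⟩ hxm

/-- If numbers on one side of `c` have average `c`, then those of positive weight equal `c`. -/
theorem eq_of_sum_eq_of_extreme {ι : Type*} [Fintype ι] {q f : ι → ℝ} {c : ℝ}
    (hq : ∀ i, 0 ≤ q i) (hq1 : ∑ i, q i = 1) (hf : ∑ i, q i * f i = c)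
    (hext : (∀ i, c ≤ f i) ∨ ∀ i, f i ≤ c) (i : ι) : q i = 0 ∨ f i = c := by
  have hsum : ∑ i, q i * (f i - c) = 0 := by
    simp only [mul_sub, Finset.sum_sub_distrib, ← Finset.sum_mul, hq1, hf]
    ring
  have : q i * (f i - c) = 0 := by
    rcases hext with h | h
    · exact (Finset.sum_eq_zero_iff_of_nonneg fun i _ =>
        mul_nonneg (hq i) (sub_nonneg.2 (h i))).1 hsum i (Finset.mem_univ i)
    · exact (Finset.sum_eq_zero_iff_of_nonpos fun i _ =>
        mul_nonpos_of_nonneg_of_nonpos (hq i) (sub_nonpos.2 (h i))).1 hsum i (Finset.mem_univ i)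
  rcases mul_eq_zero.1 this with h | h
  · exact Or.inl h
  · exact Or.inr (sub_eq_zero.1 h)

/-- Jensen's inequality for `G x ↦ G (x y)` with the points of the average given through their
`G`-values. The sign `σ` tells concavity (`σ = 1`) from convexity (`σ = -1`). -/
theorem scaled_jensen {ι : Type*} [Fintype ι] {G D D' L : ℝ → ℝ} {σ y m : ℝ} {q x : ι → ℝ}
    (hG : ContinuousOn G (Set.Icc 0 1))
    (hGD : ∀ x ∈ Set.Ioo (0 : ℝ) 1, HasDerivAt G (D x) x)
    (hD : ∀ x ∈ Set.Ioo (0 : ℝ) 1, HasDerivAt D (D' x) x)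
    (hpos : ∀ x ∈ Set.Ioo (0 : ℝ) 1, 0 < D x)
    (hL : ∀ x ∈ Set.Ioo (0 : ℝ) 1, x * D' x = L x * D x)
    (hmono : MonotoneOn (fun x => σ * L x) (Set.Ioo 0 1))
    (hq : ∀ i, 0 ≤ q i) (hq1 : ∑ i, q i = 1) (hx : ∀ i, x i ∈ Set.Icc (0 : ℝ) 1)
    (hy : y ∈ Set.Icc (0 : ℝ) 1) (hm : m ∈ Set.Icc (0 : ℝ) 1)
    (hmean : ∑ i, q i * G (x i) = G m) :
    σ * ∑ i, q i * G (x i * y) ≤ σ * G (m * y) := by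
  have hstrict : StrictMonoOn G (Set.Icc 0 1) := by
    refine strictMonoOn_of_deriv_pos (convex_Icc 0 1) hG ?_
    rw [interior_Icc]
    intro t ht
    rw [(hGD t ht).deriv]
    exact hpos t ht
  -- at an endpoint there is no tangent line, but all points of positive weight coincide with it
  have hdeg : ((∀ i, G m ≤ G (x i)) ∨ ∀ i, G (x i) ≤ G m) →
      σ * ∑ i, q i * G (x i * y) ≤ σ * G (m * y) := by
    intro hext
    refine le_of_eq (congrArg (σ * ·) ?_)
    calc ∑ i, q i * G (x i * y) = ∑ i, q i * G (m * y) := by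
          refine Finset.sum_congr rfl fun i _ => ?_
          rcases eq_of_sum_eq_of_extreme hq hq1 hmean hext i with h | h
          · simp [h]
          · rw [hstrict.injOn (hx i) hm h]
      _ = G (m * y) := by rw [← Finset.sum_mul, hq1, one_mul]
  rcases hm.1.eq_or_lt with h0 | h0
  · exact hdeg (Or.inl fun i => hstrict.monotoneOn hm (hx i) (h0 ▸ (hx i).1))
  rcases hm.2.eq_or_lt with h1 | h1
  · exact hdeg (Or.inr fun i => hstrict.monotoneOn (hx i) hm (h1 ▸ (hx i).2))
  rcases hy.1.eq_or_lt with hy0 | hy0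
  · simp [← hy0, ← Finset.sum_mul, hq1]
  rcases hy.2.eq_or_lt with hy1 | hy1
  · simp [hy1, hmean]
  obtain ⟨c, hc⟩ := scaled_tangent hG hGD hD hpos hL hmono ⟨hy0, hy1⟩ ⟨h0, h1⟩
  have hsum : ∑ i, q i * (σ * (G (x i * y) - c * G (x i))) ≤
      ∑ i, q i * (σ * (G (m * y) - c * G m)) :=
    Finset.sum_le_sum fun i _ => mul_le_mul_of_nonneg_left (hc _ (hx i)) (hq i)
  rw [← Finset.sum_mul, hq1, one_mul] at hsum
  have hsplit : ∑ i, q i * (σ * (G (x i * y) - c * G (x i))) =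
      σ * ∑ i, q i * G (x i * y) - σ * c * ∑ i, q i * G (x i) := by
    rw [Finset.mul_sum, Finset.mul_sum, ← Finset.sum_sub_distrib]
    exact Finset.sum_congr rfl fun i _ => by ring
  rw [hsplit, hmean] at hsum
  linarith

/-- The two-variable form of `scaled_jensen`, obtained by applying it in each variable. -/
theorem scaled_jensen_prod {ι κ : Type*} [Fintype ι] [Fintype κ] {G D D' L : ℝ → ℝ}
    {σ m n : ℝ} {q x : ι → ℝ} {r y : κ → ℝ}
    (hG : ContinuousOn G (Set.Icc 0 1))
    (hGD : ∀ x ∈ Set.Ioo (0 : ℝ) 1, HasDerivAt G (D x) x)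
    (hD : ∀ x ∈ Set.Ioo (0 : ℝ) 1, HasDerivAt D (D' x) x)
    (hpos : ∀ x ∈ Set.Ioo (0 : ℝ) 1, 0 < D x)
    (hL : ∀ x ∈ Set.Ioo (0 : ℝ) 1, x * D' x = L x * D x)
    (hmono : MonotoneOn (fun x => σ * L x) (Set.Ioo 0 1))
    (hq : ∀ i, 0 ≤ q i) (hq1 : ∑ i, q i = 1) (hx : ∀ i, x i ∈ Set.Icc (0 : ℝ) 1)
    (hr : ∀ j, 0 ≤ r j) (hr1 : ∑ j, r j = 1) (hy : ∀ j, y j ∈ Set.Icc (0 : ℝ) 1)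
    (hm : m ∈ Set.Icc (0 : ℝ) 1) (hmean : ∑ i, q i * G (x i) = G m)
    (hn : n ∈ Set.Icc (0 : ℝ) 1) (hnean : ∑ j, r j * G (y j) = G n) :
    σ * ∑ i, ∑ j, q i * r j * G (x i * y j) ≤ σ * G (m * n) := by
  calc σ * ∑ i, ∑ j, q i * r j * G (x i * y j)
      = ∑ j, r j * (σ * ∑ i, q i * G (x i * y j)) := by
        rw [Finset.sum_comm, Finset.mul_sum]
        simp only [Finset.mul_sum]
        exact Finset.sum_congr rfl fun j _ => Finset.sum_congr rfl fun i _ => by ring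
    _ ≤ ∑ j, r j * (σ * G (m * y j)) :=
        Finset.sum_le_sum fun j _ => mul_le_mul_of_nonneg_left
          (scaled_jensen hG hGD hD hpos hL hmono hq hq1 hx (hy j) hm hmean) (hr j)
    _ = σ * ∑ j, r j * G (y j * m) := by
        rw [Finset.mul_sum]
        exact Finset.sum_congr rfl fun j _ => by rw [mul_comm m]; ring
    _ ≤ σ * G (m * n) := by
        rw [mul_comm m]
        exact scaled_jensen hG hGD hD hpos hL hmono hr hr1 hy hm hn hnean

/-! ### The binary entropy curve -/

/-- The power sum `t ^ β + (1 - t) ^ β`, or the binary entropy of `t` if `β = 1`, as a function of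
the bias `x = 1 - 2 t`. In this parameter the binary convolution is multiplication. -/
noncomputable def biasCurve (β x : ℝ) : ℝ :=
  if β = 1 then Real.binEntropy ((1 - x) / 2)
  else ((1 + x) / 2) ^ β + ((1 - x) / 2) ^ β

theorem biasCurve_neg (β x : ℝ) : biasCurve β (-x) = biasCurve β x := by
  unfold biasCurve
  split_ifs
  · rw [← Real.binEntropy_one_sub]
    congr 1
    ring
  · rw [add_comm, sub_neg_eq_add, ← sub_eq_add_neg]

theorem biasCurve_abs (β x : ℝ) : biasCurve β |x| = biasCurve β x := by
  rcases abs_choice x with h | h <;> rw [h]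
  exact biasCurve_neg β x

theorem continuous_biasCurve {β : ℝ} (hβ : 0 < β) : Continuous (biasCurve β) := by
  unfold biasCurve
  split_ifs
  · exact Real.binEntropy_continuous.comp (by fun_prop)
  · exact ((by fun_prop : Continuous fun x : ℝ => (1 + x) / 2).rpow_const
      fun _ => Or.inr hβ.le).add ((by fun_prop : Continuous fun x : ℝ => (1 - x) / 2).rpow_const
      fun _ => Or.inr hβ.le)

theorem biasCurve_pos {β x : ℝ} (hβ : β ≠ 1) (hx : x ∈ Set.Icc (0 : ℝ) 1) :
    0 < biasCurve β x := by
  rw [biasCurve, if_neg hβ]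
  have h1 : 0 < (1 + x) / 2 := by linarith [hx.1]
  have h2 : 0 ≤ (1 - x) / 2 := by linarith [hx.2]
  exact add_pos_of_pos_of_nonneg (Real.rpow_pos_of_pos h1 _) (Real.rpow_nonneg h2 _)

theorem artanh_monotoneOn_comp {f : ℝ → ℝ} (hf : MonotoneOn f (Set.Ioi 0)) :
    MonotoneOn (fun x => f (Real.artanh x)) (Set.Ioo 0 1) := by
  have hmem : ∀ x ∈ Set.Ioo (0 : ℝ) 1, x ∈ Set.Ioo (-1 : ℝ) 1 := fun x hx =>
    ⟨by linarith [hx.1], hx.2⟩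
  have hpos : ∀ x ∈ Set.Ioo (0 : ℝ) 1, 0 < Real.artanh x := fun x hx => by
    rw [← Real.artanh_zero]
    exact Real.strictMonoOn_artanh (by norm_num) (hmem x hx) hx.1
  intro x hx y hy hxy
  exact hf (hpos x hx) (hpos y hy)
    (Real.strictMonoOn_artanh.monotoneOn (hmem x hx) (hmem y hy) hxy)

theorem one_add_tanh_div_two (s : ℝ) :
    (1 + Real.tanh s) / 2 = Real.exp s / (2 * Real.cosh s) := by
  have := (Real.cosh_pos s).ne'
  rw [Real.tanh_eq_sinh_div_cosh, ← Real.cosh_add_sinh]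
  field_simp

theorem one_sub_tanh_div_two (s : ℝ) :
    (1 - Real.tanh s) / 2 = Real.exp (-s) / (2 * Real.cosh s) := by
  simpa [sub_eq_add_neg] using one_add_tanh_div_two (-s)

/-- The elasticity `x D'(x) / D(x)` of `D(x) = ((1 + x) / 2) ^ γ - ((1 - x) / 2) ^ γ` at
`x = tanh s`. -/
theorem power_elasticity {γ s : ℝ} (hγ : γ ≠ 0) (hs : 0 < s) :
    Real.tanh s * (γ / 2 * (((1 + Real.tanh s) / 2) ^ (γ - 1) +
        ((1 - Real.tanh s) / 2) ^ (γ - 1))) =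
      γ / 2 * (1 + Real.sinh ((2 - γ) * s) / Real.sinh (γ * s)) *
        (((1 + Real.tanh s) / 2) ^ γ - ((1 - Real.tanh s) / 2) ^ γ) := by
  have hc := Real.cosh_pos s
  have hS : Real.sinh (γ * s) ≠ 0 := by
    rw [Ne, Real.sinh_eq_zero]
    exact mul_ne_zero hγ hs.ne'
  have hpow : ∀ t c : ℝ, (Real.exp t / (2 * Real.cosh s)) ^ c =
      Real.exp (t * c) / (2 * Real.cosh s) ^ c := fun t c => by
    rw [Real.div_rpow (Real.exp_pos t).le (by positivity), Real.exp_mul]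
  have hdiff : Real.exp (s * γ) - Real.exp (-s * γ) = 2 * Real.sinh (γ * s) := by
    rw [Real.sinh_eq, neg_mul, mul_comm s]
    ring
  have hadd : Real.exp (s * (γ - 1)) + Real.exp (-s * (γ - 1)) =
      2 * Real.cosh ((γ - 1) * s) := by
    rw [Real.cosh_eq, neg_mul, mul_comm s]
    ring
  have hprod : Real.sinh (γ * s) + Real.sinh ((2 - γ) * s) =
      2 * Real.sinh s * Real.cosh ((γ - 1) * s) := by
    rw [show γ * s = s + (γ - 1) * s by ring, show (2 - γ) * s = s - (γ - 1) * s by ring,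
      Real.sinh_add, Real.sinh_sub]
    ring
  have hE : (2 * Real.cosh s) ^ γ ≠ 0 := (Real.rpow_pos_of_pos (by positivity) _).ne'
  rw [one_add_tanh_div_two, one_sub_tanh_div_two, hpow, hpow, hpow, hpow, ← add_div, ← sub_div,
    hadd, hdiff, Real.rpow_sub_one (by positivity), Real.tanh_eq_sinh_div_cosh]
  field_simp
  rw [mul_comm s (2 - γ), hprod]
  ring

theorem monotoneOn_elasticity {γ : ℝ} (hγ : γ ≠ 0) (h : γ ≤ 1 ∨ 2 ≤ γ) :
    MonotoneOn (fun s => γ / 2 * (1 + Real.sinh ((2 - γ) * s) / Real.sinh (γ * s)))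
      (Set.Ioi 0) := by
  intro s hs t ht hst
  rcases lt_or_gt_of_ne hγ with hneg | hpos
  · have := sinh_mul_div_sinh_mul_monotoneOn (a := 2 - γ) (b := -γ) (by linarith)
      (by linarith) hs ht hst
    simp only [neg_mul, Real.sinh_neg, div_neg] at this
    exact mul_le_mul_of_nonpos_left (by linarith) (by linarith)
  · refine mul_le_mul_of_nonneg_left (add_le_add_right ?_ 1) (by linarith)
    rcases h with h | h
    · exact sinh_mul_div_sinh_mul_monotoneOn (by linarith) hpos hs ht hst
    · have := sinh_mul_div_sinh_mul_antitoneOn (a := γ - 2) (b := γ) (by linarith)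
        (by linarith) hpos hs ht hst
      have hn : ∀ u : ℝ, Real.sinh ((2 - γ) * u) = -Real.sinh ((γ - 2) * u) := fun u => by
        rw [← Real.sinh_neg]
        congr 1
        ring
      rw [hn, hn, neg_div, neg_div]
      exact neg_le_neg this

theorem antitoneOn_elasticity {γ : ℝ} (h1 : 1 ≤ γ) (h2 : γ ≤ 2) :
    AntitoneOn (fun s => γ / 2 * (1 + Real.sinh ((2 - γ) * s) / Real.sinh (γ * s)))
      (Set.Ioi 0) := fun s hs t ht hst =>
  mul_le_mul_of_nonneg_left (add_le_add_right (sinh_mul_div_sinh_mul_antitoneOn (by linarith)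
    (by linarith) (by linarith) hs ht hst) 1) (by linarith)

/-- With the sign `τ` chosen to make `τ * biasCurve β` increasing on `[0, 1]`, its first
derivative `D`, its second derivative `D'` and the elasticity `L` of `D` satisfy the hypotheses of
`scaled_jensen_prod`, with a direction of monotonicity of `L` that depends on `β`. -/
theorem exists_biasCurve_derivs {β : ℝ} (hβ : 0 < β) : ∃ (τ : ℝ) (D D' L : ℝ → ℝ),
    (β ≤ 1 → τ = -1) ∧ (1 < β → τ = 1) ∧
    (∀ x ∈ Set.Ioo (0 : ℝ) 1, HasDerivAt (fun x => τ * biasCurve β x) (D x) x) ∧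
    (∀ x ∈ Set.Ioo (0 : ℝ) 1, HasDerivAt D (D' x) x) ∧
    (∀ x ∈ Set.Ioo (0 : ℝ) 1, 0 < D x) ∧
    (∀ x ∈ Set.Ioo (0 : ℝ) 1, x * D' x = L x * D x) ∧
    ((β ≤ 2 ∨ 3 ≤ β) → MonotoneOn (fun x => 1 * L x) (Set.Ioo 0 1)) ∧
    ((2 ≤ β ∧ β ≤ 3) → MonotoneOn (fun x => -1 * L x) (Set.Ioo 0 1)) := by
  have hp : ∀ x : ℝ, HasDerivAt (fun x : ℝ => (1 + x) / 2) (1 / 2) x := fun x =>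
    ((hasDerivAt_id x).const_add 1).div_const 2
  have hm : ∀ x : ℝ, HasDerivAt (fun x : ℝ => (1 - x) / 2) (-1 / 2) x := fun x =>
    ((hasDerivAt_id x).const_sub 1).div_const 2
  have hpp : ∀ x ∈ Set.Ioo (0 : ℝ) 1, 0 < (1 + x) / 2 := fun x hx => by linarith [hx.1]
  have hmp : ∀ x ∈ Set.Ioo (0 : ℝ) 1, 0 < (1 - x) / 2 := fun x hx => by linarith [hx.2]
  have hlt : ∀ x ∈ Set.Ioo (0 : ℝ) 1, (1 - x) / 2 < (1 + x) / 2 := fun x hx => by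
    linarith [hx.1]
  have hmem : ∀ x ∈ Set.Ioo (0 : ℝ) 1, x ∈ Set.Ioo (-1 : ℝ) 1 := fun x hx =>
    ⟨by linarith [hx.1], hx.2⟩
  have hart : ∀ x ∈ Set.Ioo (0 : ℝ) 1, 0 < Real.artanh x := fun x hx => by
    rw [← Real.artanh_zero]
    exact Real.strictMonoOn_artanh (by norm_num) (hmem x hx) hx.1
  by_cases h1 : β = 1
  · have hD : ∀ x ∈ Set.Ioo (0 : ℝ) 1,
        1 / 2 * (Real.log ((1 + x) / 2) - Real.log ((1 - x) / 2)) = Real.artanh x := by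
      intro x hx
      rw [Real.artanh_eq_half_log ⟨(hmem x hx).1.le, hx.2.le⟩,
        ← Real.log_div (hpp x hx).ne' (hmp x hx).ne']
      congr 2
      have : 1 - x ≠ 0 := by linarith [hx.2]
      field_simp
    refine ⟨-1, fun x => 1 / 2 * (Real.log ((1 + x) / 2) - Real.log ((1 - x) / 2)),
      fun x => 1 / (1 - x ^ 2),
      fun x => Real.sinh (2 * Real.artanh x) / (2 * Real.artanh x), fun _ => rfl,
      fun h => absurd h1 h.ne', fun x hx => ?_, fun x hx => ?_, fun x hx => ?_, fun x hx => ?_,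
      fun _ => ?_, fun h => by linarith [h.1]⟩
    · simp only [biasCurve, if_pos h1]
      have h := (Real.hasDerivAt_binEntropy (hmp x hx).ne'
        (by linarith [hx.1] : (1 - x) / 2 ≠ 1)).comp x (hm x)
      refine (h.const_mul (-1)).congr_deriv ?_
      rw [show 1 - (1 - x) / 2 = (1 + x) / 2 by ring]
      ring
    · refine ((((hp x).log (hpp x hx).ne').sub ((hm x).log (hmp x hx).ne')).const_mul
        (1 / 2)).congr_deriv ?_
      have h1 : 1 - x ≠ 0 := by linarith [hx.2]
      have h2 : 1 + x ≠ 0 := by linarith [hx.1]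
      beta_reduce
      rw [show 1 - x ^ 2 = (1 - x) * (1 + x) by ring]
      field_simp
      ring
    · exact mul_pos (by norm_num) (sub_pos.2 (Real.log_lt_log (hmp x hx) (hlt x hx)))
    · have h2 : (0 : ℝ) < 1 - x ^ 2 := by nlinarith [hx.1, hx.2]
      have h3 := (hart x hx).ne'
      simp only [hD x hx]
      rw [Real.sinh_two_mul, Real.sinh_artanh (hmem x hx), Real.cosh_artanh (hmem x hx)]
      have h4 : √(1 - x ^ 2) ≠ 0 := (Real.sqrt_pos.2 h2).ne'
      have h5 := Real.sq_sqrt h2.le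
      field_simp
      rw [h5]
    · simp only [one_mul]
      refine artanh_monotoneOn_comp (f := fun s => Real.sinh (2 * s) / (2 * s)) ?_
      intro s hs t ht hst
      have hs' : (0 : ℝ) < s := hs
      have ht' : (0 : ℝ) < t := ht
      exact sinh_div_self_monotoneOn (by simpa using hs') (by simpa using ht') (by linarith)
  · have hγ : β - 1 ≠ 0 := sub_ne_zero.2 h1
    set γ := β - 1 with hγdef
    have hpow : ∀ c : ℝ, ∀ x ∈ Set.Ioo (0 : ℝ) 1,
        HasDerivAt (fun x : ℝ => ((1 + x) / 2) ^ c) (c / 2 * ((1 + x) / 2) ^ (c - 1)) x :=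
      fun c x hx => ((hp x).rpow_const (Or.inl (hpp x hx).ne')).congr_deriv (by ring)
    have hpow' : ∀ c : ℝ, ∀ x ∈ Set.Ioo (0 : ℝ) 1,
        HasDerivAt (fun x : ℝ => ((1 - x) / 2) ^ c) (-(c / 2 * ((1 - x) / 2) ^ (c - 1))) x :=
      fun c x hx => ((hm x).rpow_const (Or.inl (hmp x hx).ne')).congr_deriv (by ring)
    refine ⟨if β < 1 then -1 else 1,
      fun x => (if β < 1 then -1 else 1) * (β / 2) * (((1 + x) / 2) ^ γ - ((1 - x) / 2) ^ γ),
      fun x => (if β < 1 then -1 else 1) * (β / 2) * (γ / 2 *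
        (((1 + x) / 2) ^ (γ - 1) + ((1 - x) / 2) ^ (γ - 1))),
      fun x => γ / 2 * (1 + Real.sinh ((2 - γ) * Real.artanh x) /
        Real.sinh (γ * Real.artanh x)), fun h => if_pos (lt_of_le_of_ne h h1),
      fun h => if_neg h.not_gt, fun x hx => ?_, fun x hx => ?_, fun x hx => ?_, fun x hx => ?_,
      fun h => ?_, fun h => ?_⟩
    · simp only [biasCurve, if_neg h1]
      refine (((hpow β x hx).add (hpow' β x hx)).const_mul _).congr_deriv ?_
      ring
    · refine (((hpow γ x hx).sub (hpow' γ x hx)).const_mul _).congr_deriv ?_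
      ring
    · rcases lt_or_gt_of_ne h1 with h | h
      · simp only [if_pos h]
        have := Real.rpow_lt_rpow_of_neg (hmp x hx) (hlt x hx) (by linarith : γ < 0)
        nlinarith
      · simp only [if_neg h.not_gt]
        have := Real.rpow_lt_rpow (hmp x hx).le (hlt x hx) (by linarith : 0 < γ)
        nlinarith
    · have h := power_elasticity hγ (hart x hx)
      rw [Real.tanh_artanh (hmem x hx)] at h
      linear_combination (if β < 1 then -1 else 1) * (β / 2) * h
    · simp only [one_mul]
      exact artanh_monotoneOn_comp (monotoneOn_elasticity hγ
        (h.imp (fun h => by linarith) fun h => by linarith))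
    · refine artanh_monotoneOn_comp (f := fun s => -1 * (γ / 2 *
        (1 + Real.sinh ((2 - γ) * s) / Real.sinh (γ * s)))) fun s hs t ht hst => ?_
      have := antitoneOn_elasticity (by linarith [h.1] : 1 ≤ γ) (by linarith [h.2]) hs ht hst
      simp only at this ⊢
      linarith

theorem biasCurve_injOn {β : ℝ} (hβ : 0 < β) : Set.InjOn (biasCurve β) (Set.Icc 0 1) := by
  obtain ⟨τ, D, D', L, -, -, hGD, -, hpos, -⟩ := exists_biasCurve_derivs hβ
  have hstrict : StrictMonoOn (fun x => τ * biasCurve β x) (Set.Icc 0 1) := by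
    refine strictMonoOn_of_deriv_pos (convex_Icc 0 1)
      (continuous_const.mul (continuous_biasCurve hβ)).continuousOn ?_
    rw [interior_Icc]
    intro t ht
    rw [(hGD t ht).deriv]
    exact hpos t ht
  exact fun x hx y hy hxy => hstrict.injOn hx hy (congrArg (τ * ·) hxy)

/-- Averages of values of the curve are values of the curve. -/
theorem exists_biasCurve_eq_sum {ι : Type*} [Fintype ι] {β : ℝ} (hβ : 0 < β) {q x : ι → ℝ}
    (hq : ∀ i, 0 ≤ q i) (hq1 : ∑ i, q i = 1) (hx : ∀ i, |x i| ≤ 1) :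
    ∃ m ∈ Set.Icc (0 : ℝ) 1, biasCurve β m = ∑ i, q i * biasCurve β (x i) := by
  have hconv : Convex ℝ (biasCurve β '' Set.Icc 0 1) :=
    (isPreconnected_Icc.image _ (continuous_biasCurve hβ).continuousOn).ordConnected.convex
  exact hconv.sum_mem (fun i _ => hq i) hq1 fun i _ =>
    ⟨|x i|, ⟨abs_nonneg _, hx i⟩, biasCurve_abs β (x i)⟩

/-- The average of `biasCurve β (x y)` over independent `x` and `y`, compared with the value at
constant `x` and `y` with the same averages of `biasCurve β`. -/
theorem sum_biasCurve_mul {ι κ : Type*} [Fintype ι] [Fintype κ] {β m n : ℝ} (hβ : 0 < β)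
    {q x : ι → ℝ} {r y : κ → ℝ}
    (hq : ∀ i, 0 ≤ q i) (hq1 : ∑ i, q i = 1) (hx : ∀ i, |x i| ≤ 1)
    (hr : ∀ j, 0 ≤ r j) (hr1 : ∑ j, r j = 1) (hy : ∀ j, |y j| ≤ 1)
    (hm : m ∈ Set.Icc (0 : ℝ) 1) (hmean : ∑ i, q i * biasCurve β (x i) = biasCurve β m)
    (hn : n ∈ Set.Icc (0 : ℝ) 1) (hnean : ∑ j, r j * biasCurve β (y j) = biasCurve β n) :
    (β ≤ 1 → biasCurve β (m * n) ≤ ∑ i, ∑ j, q i * r j * biasCurve β (x i * y j)) ∧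
    ((1 < β ∧ β ≤ 2 ∨ 3 ≤ β) →
      ∑ i, ∑ j, q i * r j * biasCurve β (x i * y j) ≤ biasCurve β (m * n)) ∧
    (2 ≤ β ∧ β ≤ 3 →
      biasCurve β (m * n) ≤ ∑ i, ∑ j, q i * r j * biasCurve β (x i * y j)) := by
  obtain ⟨τ, D, D', L, hτ1, hτ2, hGD, hD, hpos, hL, hmono, hanti⟩ := exists_biasCurve_derivs hβ
  have key : ∀ σ : ℝ, MonotoneOn (fun x => σ * L x) (Set.Ioo 0 1) →
      σ * (τ * ∑ i, ∑ j, q i * r j * biasCurve β (x i * y j)) ≤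
        σ * (τ * biasCurve β (m * n)) := by
    intro σ hσ
    have h := scaled_jensen_prod (G := fun x => τ * biasCurve β x) (x := fun i => |x i|)
      (y := fun j => |y j|)
      (continuous_const.mul (continuous_biasCurve hβ)).continuousOn hGD hD hpos hL hσ
      hq hq1 (fun i => ⟨abs_nonneg _, hx i⟩) hr hr1 (fun j => ⟨abs_nonneg _, hy j⟩)
      hm (by rw [← hmean, Finset.mul_sum]
             exact Finset.sum_congr rfl fun i _ => by rw [biasCurve_abs]; ring)
      hn (by rw [← hnean, Finset.mul_sum]
             exact Finset.sum_congr rfl fun i _ => by rw [biasCurve_abs]; ring)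
    refine le_trans (le_of_eq ?_) h
    congr 1
    simp only [Finset.mul_sum, ← abs_mul, biasCurve_abs]
    exact Finset.sum_congr rfl fun i _ => Finset.sum_congr rfl fun j _ => by ring
  refine ⟨fun h => ?_, fun h => ?_, fun h => ?_⟩
  · have := key 1 (hmono (Or.inl (by linarith)))
    rw [hτ1 h] at this
    linarith
  · have := key 1 (hmono (h.imp And.right id))
    rw [hτ2 (by rcases h with h | h <;> [exact h.1; linarith])] at this
    linarith
  · have := key (-1) (hanti h)
    rw [hτ2 (by linarith [h.1])] at this
    linarith

/-! ### Tilting the conditional distribution of a bit -/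

/-- The `ℓ^α` mass `(a ^ α + b ^ α) ^ (1 / α)` of a pair of weights. -/
noncomputable def powerMass (α a b : ℝ) : ℝ := (a ^ α + b ^ α) ^ (1 / α)

/-- The bias of the distribution on a bit with probabilities proportional to `a ^ α, b ^ α`. It
is `0` for `a = b = 0`, where the mass vanishes. -/
noncomputable def tiltedBias (α a b : ℝ) : ℝ := (a ^ α - b ^ α) / (a ^ α + b ^ α)

theorem powerMass_nonneg {α a b : ℝ} (ha : 0 ≤ a) (hb : 0 ≤ b) : 0 ≤ powerMass α a b :=
  Real.rpow_nonneg (add_nonneg (Real.rpow_nonneg ha _) (Real.rpow_nonneg hb _)) _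

theorem powerMass_comm (α a b : ℝ) : powerMass α a b = powerMass α b a := by
  rw [powerMass, powerMass, add_comm]

theorem tiltedBias_comm (α a b : ℝ) : tiltedBias α a b = -tiltedBias α b a := by
  rw [tiltedBias, tiltedBias, add_comm, ← neg_div, neg_sub]

theorem abs_tiltedBias_le_one {α a b : ℝ} (ha : 0 ≤ a) (hb : 0 ≤ b) :
    |tiltedBias α a b| ≤ 1 := by
  have h1 := Real.rpow_nonneg ha α
  have h2 := Real.rpow_nonneg hb α
  rw [tiltedBias, abs_div, abs_of_nonneg (add_nonneg h1 h2)]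
  refine div_le_one_of_le₀ (abs_le.2 ⟨by linarith, by linarith⟩) (add_nonneg h1 h2)

theorem rpow_add_rpow_mul_tiltedBias {α a b : ℝ} (ha : 0 ≤ a) (hb : 0 ≤ b) :
    (a ^ α + b ^ α) * tiltedBias α a b = a ^ α - b ^ α := by
  rcases eq_or_ne (a ^ α + b ^ α) 0 with h | h
  · have h1 := Real.rpow_nonneg ha α
    have h2 := Real.rpow_nonneg hb α
    rw [h, zero_mul]
    linarith
  · exact mul_div_cancel₀ _ h

/-- The `ℓ^α` mass of a product pair in terms of the masses and tilted biases of the factors. -/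
theorem powerMass_mul {α a b c d : ℝ} (ha : 0 ≤ a) (hb : 0 ≤ b) (hc : 0 ≤ c) (hd : 0 ≤ d) :
    powerMass α (a * c) (b * d) = powerMass α a b * powerMass α c d *
      ((1 + tiltedBias α a b * tiltedBias α c d) / 2) ^ (1 / α) := by
  have h1 := abs_le.1 (abs_tiltedBias_le_one (α := α) ha hb)
  have h2 := abs_le.1 (abs_tiltedBias_le_one (α := α) hc hd)
  have hab : 0 ≤ a ^ α + b ^ α := add_nonneg (Real.rpow_nonneg ha _) (Real.rpow_nonneg hb _)
  have hcd : 0 ≤ c ^ α + d ^ α := add_nonneg (Real.rpow_nonneg hc _) (Real.rpow_nonneg hd _)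
  have h3 : 0 ≤ (1 + tiltedBias α a b * tiltedBias α c d) / 2 := by nlinarith
  rw [powerMass, powerMass, powerMass, ← Real.mul_rpow hab hcd,
    ← Real.mul_rpow (mul_nonneg hab hcd) h3, Real.mul_rpow ha hc, Real.mul_rpow hb hd]
  congr 1
  have e1 := rpow_add_rpow_mul_tiltedBias (α := α) ha hb
  have e2 := rpow_add_rpow_mul_tiltedBias (α := α) hc hd
  linear_combination (-1 / 2) * (c ^ α + d ^ α) * tiltedBias α c d * e1 -
    (1 / 2) * (a ^ α - b ^ α) * e2

theorem powerMass_mul_add_powerMass_mul {α a b c d : ℝ} (hα : α ≠ 1)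
    (ha : 0 ≤ a) (hb : 0 ≤ b) (hc : 0 ≤ c) (hd : 0 ≤ d) :
    powerMass α (a * c) (b * d) + powerMass α (b * c) (a * d) =
      powerMass α a b * powerMass α c d *
        biasCurve (1 / α) (tiltedBias α a b * tiltedBias α c d) := by
  rw [powerMass_mul ha hb hc hd, powerMass_mul hb ha hc hd, powerMass_comm α b a,
    tiltedBias_comm α b a, biasCurve, if_neg (by simpa using hα)]
  ring_nf

theorem add_eq_powerMass_mul_biasCurve {α a b : ℝ} (hα0 : 0 < α) (hα : α ≠ 1)
    (ha : 0 ≤ a) (hb : 0 ≤ b) :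
    a + b = powerMass α a b * biasCurve (1 / α) (tiltedBias α a b) := by
  have h1 := abs_le.1 (abs_tiltedBias_le_one (α := α) ha hb)
  have hab : 0 ≤ a ^ α + b ^ α := add_nonneg (Real.rpow_nonneg ha _) (Real.rpow_nonneg hb _)
  have e1 := rpow_add_rpow_mul_tiltedBias (α := α) ha hb
  rw [biasCurve, if_neg (by simpa using hα), powerMass, mul_add,
    ← Real.mul_rpow hab (by linarith), ← Real.mul_rpow hab (by linarith),
    show (a ^ α + b ^ α) * ((1 + tiltedBias α a b) / 2) = a ^ α by
      linear_combination (1 / 2) * e1,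
    show (a ^ α + b ^ α) * ((1 - tiltedBias α a b) / 2) = b ^ α by
      linear_combination (-1 / 2) * e1,
    one_div, Real.rpow_rpow_inv ha hα0.ne', Real.rpow_rpow_inv hb hα0.ne']

theorem powerMass_one (a b : ℝ) : powerMass 1 a b = a + b := by simp [powerMass]

theorem tiltedBias_one (a b : ℝ) : tiltedBias 1 a b = (a - b) / (a + b) := by simp [tiltedBias]

/-- The grouping property of Shannon entropy, for two unnormalized weights. -/
theorem negMulLog_add_negMulLog {a b : ℝ} (ha : 0 ≤ a) (hb : 0 ≤ b) :
    Real.negMulLog a + Real.negMulLog b - Real.negMulLog (a + b) =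
      (a + b) * biasCurve 1 ((a - b) / (a + b)) := by
  rcases eq_or_ne (a + b) 0 with h | h
  · have ha0 : a = 0 := by linarith
    have hb0 : b = 0 := by linarith
    simp [ha0, hb0]
  · have e1 : (1 - (a - b) / (a + b)) / 2 = b / (a + b) := by
      field_simp
      ring
    have e2 : 1 - b / (a + b) = a / (a + b) := by
      field_simp
      ring
    rw [biasCurve, if_pos rfl, Real.binEntropy_eq_negMulLog_add_negMulLog_one_sub, e1, e2]
    have h1 := Real.negMulLog_mul (a + b) (a / (a + b))
    have h2 := Real.negMulLog_mul (a + b) (b / (a + b))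
    rw [mul_div_cancel₀ _ h] at h1 h2
    rw [h1, h2, ← e2]
    ring

/-- The entropy of `X₂` given `X₁ + X₂` by the chain rule, for unnormalized weights. -/
theorem negMulLog_chain {a b c d : ℝ} (ha : 0 ≤ a) (hb : 0 ≤ b) (hc : 0 ≤ c) (hd : 0 ≤ d) :
    (Real.negMulLog (a * c) + Real.negMulLog (b * d) - Real.negMulLog (a * c + b * d)) +
      (Real.negMulLog (b * c) + Real.negMulLog (a * d) - Real.negMulLog (b * c + a * d)) =
      (a + b) * (c + d) * (biasCurve 1 ((a - b) / (a + b)) + biasCurve 1 ((c - d) / (c + d)) -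
        biasCurve 1 ((a - b) / (a + b) * ((c - d) / (c + d)))) := by
  have h1 := negMulLog_add_negMulLog ha hb
  have h2 := negMulLog_add_negMulLog hc hd
  have h3 := negMulLog_add_negMulLog (a := a * c + b * d) (b := b * c + a * d)
    (by positivity) (by positivity)
  rw [show a * c + b * d + (b * c + a * d) = (a + b) * (c + d) by ring,
    show a * c + b * d - (b * c + a * d) = (a - b) * (c - d) by ring,
    mul_div_mul_comm, Real.negMulLog_mul] at h3
  simp only [Real.negMulLog_mul]
  linear_combination (c + d) * h1 + (a + b) * h2 - h3

/-! ### Conditional entropies as averages -/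

/-- The entropy as a function of the value of `biasCurve β`. -/
noncomputable def curveEntropy (β v : ℝ) : ℝ := if β = 1 then v else 1 / (1 - β) * Real.log v

theorem binRenyi_eq_curveEntropy (β x : ℝ) :
    binRenyi β ((1 - x) / 2) = curveEntropy β (biasCurve β x) := by
  unfold binRenyi curveEntropy biasCurve
  split_ifs
  · rfl
  · rw [add_comm]
    ring_nf

theorem sum_zmod_two (f : ZMod 2 → ℝ) : ∑ i, f i = f 0 + f 1 := Fin.sum_univ_two f

section Channel

variable {Y : Type*}

/-- The `ℓ^α` mass of `p(·, y)`. -/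
noncomputable def channelMass (α : ℝ) (p : ZMod 2 × Y → ℝ) (y : Y) : ℝ :=
  powerMass α (p (0, y)) (p (1, y))

/-- The bias of the bit distribution proportional to `p(·, y) ^ α`. -/
noncomputable def channelBias (α : ℝ) (p : ZMod 2 × Y → ℝ) (y : Y) : ℝ :=
  tiltedBias α (p (0, y)) (p (1, y))

theorem marginal_mul_rpow {α : ℝ} (hα : 0 < α) {p : ZMod 2 × Y → ℝ} (hp : ∀ w, 0 ≤ p w) (y : Y) :
    marginal p y * (∑ x, condProb p x y ^ α) ^ (1 / α) = channelMass α p y := by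
  simp only [condProb, sum_zmod_two, channelMass, powerMass]
  have h0 := hp (0, y)
  have h1 := hp (1, y)
  have hm : marginal p y = p (0, y) + p (1, y) := sum_zmod_two _
  rcases eq_or_ne (marginal p y) 0 with h | h
  · have e0 : p (0, y) = 0 := by linarith
    have e1 : p (1, y) = 0 := by linarith
    simp [h, e0, e1, Real.zero_rpow hα.ne', hα.ne']
  · have hmpos : 0 ≤ marginal p y := by linarith
    rw [Real.div_rpow h0 hmpos, Real.div_rpow h1 hmpos, ← add_div,
      Real.div_rpow (add_nonneg (Real.rpow_nonneg h0 _) (Real.rpow_nonneg h1 _))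
        (Real.rpow_nonneg hmpos _), one_div, Real.rpow_rpow_inv hmpos hα.ne',
      mul_div_cancel₀ _ h]

theorem arimotoEntropy_of_ne_one [Fintype Y] {α : ℝ} (hα : 0 < α) (hα1 : α ≠ 1)
    {p : ZMod 2 × Y → ℝ} (hp : ∀ w, 0 ≤ p w) :
    arimotoEntropy α p = α / (1 - α) * Real.log (∑ y, channelMass α p y) := by
  rw [arimotoEntropy, if_neg hα1]
  simp only [marginal_mul_rpow hα hp]

theorem arimotoEntropy_one [Fintype Y] {p : ZMod 2 × Y → ℝ} (hp : ∀ w, 0 ≤ p w) :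
    arimotoEntropy 1 p = ∑ y, (Real.negMulLog (p (0, y)) + Real.negMulLog (p (1, y)) -
      Real.negMulLog (p (0, y) + p (1, y))) := by
  rw [arimotoEntropy, if_pos rfl]
  refine Finset.sum_congr rfl fun y _ => ?_
  have h0 := hp (0, y)
  have h1 := hp (1, y)
  have hm : marginal p y = p (0, y) + p (1, y) := sum_zmod_two _
  simp only [condProb, sum_zmod_two]
  rw [← hm]
  rcases eq_or_ne (marginal p y) 0 with h | h
  · have e0 : p (0, y) = 0 := by linarith
    have e1 : p (1, y) = 0 := by linarith
    simp [h, e0, e1]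
  · have h2 := Real.negMulLog_mul (marginal p y) (p (0, y) / marginal p y)
    have h3 := Real.negMulLog_mul (marginal p y) (p (1, y) / marginal p y)
    rw [mul_div_cancel₀ _ h] at h2 h3
    have h4 : p (0, y) / marginal p y + p (1, y) / marginal p y = 1 := by
      rw [← add_div, ← hm, div_self h]
    linear_combination (-1) * h2 - h3 - Real.negMulLog (marginal p y) * h4

theorem sum_add_eq_one [Fintype Y] {p : ZMod 2 × Y → ℝ} (hp : p ∈ stdSimplex ℝ (ZMod 2 × Y)) :
    ∑ y, (p (0, y) + p (1, y)) = 1 := by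
  rw [← hp.2, Fintype.sum_prod_type, sum_zmod_two, Finset.sum_add_distrib]

theorem channelMass_nonneg (α : ℝ) {p : ZMod 2 × Y → ℝ} (hp : ∀ w, 0 ≤ p w) (y : Y) :
    0 ≤ channelMass α p y := powerMass_nonneg (hp _) (hp _)

theorem abs_channelBias_le_one (α : ℝ) {p : ZMod 2 × Y → ℝ} (hp : ∀ w, 0 ≤ p w) (y : Y) :
    |channelBias α p y| ≤ 1 := abs_tiltedBias_le_one (hp _) (hp _)

theorem sum_channelMass_mul_biasCurve [Fintype Y] {α : ℝ} (hα : 0 < α) (hα1 : α ≠ 1)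
    {p : ZMod 2 × Y → ℝ} (hp : p ∈ stdSimplex ℝ (ZMod 2 × Y)) :
    ∑ y, channelMass α p y * biasCurve (1 / α) (channelBias α p y) = 1 := by
  refine Eq.trans (Finset.sum_congr rfl fun y _ => ?_) (sum_add_eq_one hp)
  exact (add_eq_powerMass_mul_biasCurve hα hα1 (hp.1 _) (hp.1 _)).symm

theorem sum_channelMass_one [Fintype Y] {p : ZMod 2 × Y → ℝ}
    (hp : p ∈ stdSimplex ℝ (ZMod 2 × Y)) : ∑ y, channelMass 1 p y = 1 := by
  refine Eq.trans (Finset.sum_congr rfl fun y _ => ?_) (sum_add_eq_one hp)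
  rw [channelMass, powerMass_one]

theorem sum_channelMass_pos [Fintype Y] {α : ℝ} (hα : 0 < α)
    {p : ZMod 2 × Y → ℝ} (hp : p ∈ stdSimplex ℝ (ZMod 2 × Y)) :
    0 < ∑ y, channelMass α p y := by
  rcases eq_or_ne α 1 with rfl | hα1
  · rw [sum_channelMass_one hp]
    exact one_pos
  refine lt_of_le_of_ne (Finset.sum_nonneg fun y _ => channelMass_nonneg α hp.1 y) fun h => ?_
  have h0 := (Finset.sum_eq_zero_iff_of_nonneg
    fun y _ => channelMass_nonneg α hp.1 y).1 h.symm
  have h1 := sum_channelMass_mul_biasCurve hα hα1 hp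
  rw [Finset.sum_eq_zero fun y hy => by rw [h0 y hy, zero_mul]] at h1
  exact zero_ne_one h1

/-- The normalized masses. -/
noncomputable def channelWeight [Fintype Y] (α : ℝ) (p : ZMod 2 × Y → ℝ) (y : Y) : ℝ :=
  channelMass α p y / ∑ y, channelMass α p y

theorem channelWeight_nonneg [Fintype Y] (α : ℝ) {p : ZMod 2 × Y → ℝ} (hp : ∀ w, 0 ≤ p w)
    (y : Y) : 0 ≤ channelWeight α p y :=
  div_nonneg (channelMass_nonneg α hp y) (Finset.sum_nonneg fun y _ => channelMass_nonneg α hp y)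

theorem sum_channelWeight [Fintype Y] {α : ℝ} (hα : 0 < α)
    {p : ZMod 2 × Y → ℝ} (hp : p ∈ stdSimplex ℝ (ZMod 2 × Y)) :
    ∑ y, channelWeight α p y = 1 := by
  simp only [channelWeight]
  rw [← Finset.sum_div, div_self (sum_channelMass_pos hα hp).ne']

/-- The Arimoto entropy is a function of the average of `biasCurve (1 / α)`. -/
theorem arimotoEntropy_eq_curveEntropy [Fintype Y] {α : ℝ} (hα : 0 < α)
    {p : ZMod 2 × Y → ℝ} (hp : p ∈ stdSimplex ℝ (ZMod 2 × Y)) :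
    arimotoEntropy α p = curveEntropy (1 / α)
      (∑ y, channelWeight α p y * biasCurve (1 / α) (channelBias α p y)) := by
  rcases eq_or_ne α 1 with rfl | hα1
  · rw [arimotoEntropy_one hp.1, curveEntropy, if_pos (by norm_num)]
    refine Finset.sum_congr rfl fun y _ => ?_
    rw [channelWeight, sum_channelMass_one hp, channelMass, channelBias, powerMass_one,
      tiltedBias_one, negMulLog_add_negMulLog (hp.1 _) (hp.1 _)]
    norm_num
  · rw [arimotoEntropy_of_ne_one hα hα1 hp.1, curveEntropy, if_neg (by simpa using hα1)]
    simp only [channelWeight, div_mul_eq_mul_div]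
    rw [← Finset.sum_div, sum_channelMass_mul_biasCurve hα hα1 hp, one_div (∑ y, _),
      Real.log_inv]
    have h1 : 1 - α ≠ 0 := sub_ne_zero.2 hα1.symm
    have h2 : α - 1 ≠ 0 := sub_ne_zero.2 hα1
    field_simp
    ring

end Channel

/-- The entropy at the variable node: the chain rule, with the entropy of `X₁ + X₂` replaced by an
average over products of biases. -/
theorem arimotoEntropy_variableNode {Y₁ Y₂ : Type*} [Fintype Y₁] [Fintype Y₂] {α : ℝ} (hα : 0 < α)
    {p₁ : ZMod 2 × Y₁ → ℝ} {p₂ : ZMod 2 × Y₂ → ℝ}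
    (h₁ : p₁ ∈ stdSimplex ℝ (ZMod 2 × Y₁)) (h₂ : p₂ ∈ stdSimplex ℝ (ZMod 2 × Y₂)) :
    arimotoEntropy α (variableNode p₁ p₂) = arimotoEntropy α p₁ + arimotoEntropy α p₂ -
      curveEntropy (1 / α) (∑ y₁, ∑ y₂, channelWeight α p₁ y₁ * channelWeight α p₂ y₂ *
        biasCurve (1 / α) (channelBias α p₁ y₁ * channelBias α p₂ y₂)) := by
  have hn := variableNode_mem_stdSimplex h₁ h₂
  have h11 : (1 : ZMod 2) + 1 = 0 := rfl
  rcases eq_or_ne α 1 with rfl | hα1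
  · rw [arimotoEntropy_one hn.1, arimotoEntropy_eq_curveEntropy one_pos h₁,
      arimotoEntropy_eq_curveEntropy one_pos h₂, div_one]
    simp only [curveEntropy, if_true]
    have s1 := sum_channelWeight one_pos h₁
    have s2 := sum_channelWeight one_pos h₂
    have e1 : ∑ y₁, channelWeight 1 p₁ y₁ * biasCurve 1 (channelBias 1 p₁ y₁) =
        ∑ y₁, ∑ y₂, channelWeight 1 p₁ y₁ * channelWeight 1 p₂ y₂ *
          biasCurve 1 (channelBias 1 p₁ y₁) := by
      refine Finset.sum_congr rfl fun y₁ _ => ?_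
      rw [← Finset.sum_mul, ← Finset.mul_sum, s2, mul_one]
    have e2 : ∑ y₂, channelWeight 1 p₂ y₂ * biasCurve 1 (channelBias 1 p₂ y₂) =
        ∑ y₁, ∑ y₂, channelWeight 1 p₁ y₁ * channelWeight 1 p₂ y₂ *
          biasCurve 1 (channelBias 1 p₂ y₂) := by
      rw [Finset.sum_comm]
      refine Finset.sum_congr rfl fun y₂ _ => ?_
      rw [← Finset.sum_mul, ← Finset.sum_mul, s1, one_mul]
    rw [e1, e2, Fintype.sum_prod_type, sum_zmod_two, Fintype.sum_prod_type,
      Fintype.sum_prod_type]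
    simp only [← Finset.sum_add_distrib, ← Finset.sum_sub_distrib]
    refine Finset.sum_congr rfl fun y₁ _ => Finset.sum_congr rfl fun y₂ _ => ?_
    simp only [channelWeight, sum_channelMass_one h₁, sum_channelMass_one h₂, div_one]
    simp only [channelMass, channelBias, powerMass_one, tiltedBias_one, variableNode, zero_add, add_zero,
      h11]
    rw [negMulLog_chain (h₁.1 _) (h₁.1 _) (h₂.1 _) (h₂.1 _)]
    ring
  · rw [arimotoEntropy_of_ne_one hα hα1 hn.1, arimotoEntropy_of_ne_one hα hα1 h₁.1,
      arimotoEntropy_of_ne_one hα hα1 h₂.1, curveEntropy, if_neg (by simpa using hα1)]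
    have hA₁ := sum_channelMass_pos hα h₁
    have hA₂ := sum_channelMass_pos hα h₂
    have hA := sum_channelMass_pos hα hn
    have hS : ∑ y₁, ∑ y₂, channelWeight α p₁ y₁ * channelWeight α p₂ y₂ *
        biasCurve (1 / α) (channelBias α p₁ y₁ * channelBias α p₂ y₂) =
        (∑ w, channelMass α (variableNode p₁ p₂) w) /
          ((∑ y, channelMass α p₁ y) * ∑ y, channelMass α p₂ y) := by
      rw [Fintype.sum_prod_type, sum_zmod_two, Fintype.sum_prod_type, Fintype.sum_prod_type]
      simp only [← Finset.sum_add_distrib, Finset.sum_div]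
      refine Finset.sum_congr rfl fun y₁ _ => Finset.sum_congr rfl fun y₂ _ => ?_
      simp only [channelWeight, channelMass, channelBias, variableNode, zero_add, add_zero, h11]
      rw [powerMass_mul_add_powerMass_mul hα1 (h₁.1 _) (h₁.1 _) (h₂.1 _) (h₂.1 _),
        div_mul_div_comm, div_mul_eq_mul_div]
    rw [hS, Real.log_div hA.ne' (mul_pos hA₁ hA₂).ne', Real.log_mul hA₁.ne' hA₂.ne']
    have h1 : 1 - α ≠ 0 := sub_ne_zero.2 hα1.symm
    have h2 : α - 1 ≠ 0 := sub_ne_zero.2 hα1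
    field_simp
    ring

/-! ### The comparison with binary symmetric channels -/

theorem curveEntropy_le_of_le_one {β v w : ℝ} (hβ : β ≤ 1) (hv : β ≠ 1 → 0 < v) (hvw : v ≤ w) :
    curveEntropy β v ≤ curveEntropy β w := by
  unfold curveEntropy
  split_ifs with h
  · exact hvw
  · exact mul_le_mul_of_nonneg_left (Real.log_le_log (hv h) hvw)
      (one_div_nonneg.2 (by linarith))

theorem curveEntropy_le_of_one_lt {β v w : ℝ} (hβ : 1 < β) (hv : 0 < v) (hvw : v ≤ w) :
    curveEntropy β w ≤ curveEntropy β v := by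
  have h : 1 / (1 - β) ≤ 0 := div_nonpos_of_nonneg_of_nonpos zero_le_one (by linarith)
  rw [curveEntropy, curveEntropy, if_neg hβ.ne', if_neg hβ.ne']
  exact mul_le_mul_of_nonpos_left (Real.log_le_log hv hvw) h

theorem curveEntropy_injective_of_pos {β v w : ℝ} (hv : β ≠ 1 → 0 < v) (hw : β ≠ 1 → 0 < w)
    (h : curveEntropy β v = curveEntropy β w) : v = w := by
  unfold curveEntropy at h
  split_ifs at h with hβ
  · exact h
  · have h1 : 1 / (1 - β) ≠ 0 := one_div_ne_zero (sub_ne_zero.2 (Ne.symm hβ))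
    exact Real.log_injOn_pos (hv hβ) (hw hβ) (mul_left_cancel₀ h1 h)

theorem binRenyi_injOn {β : ℝ} (hβ : 0 < β) : Set.InjOn (binRenyi β) (Set.Icc 0 (1 / 2)) := by
  intro s hs t ht hst
  have hmem : ∀ u ∈ Set.Icc (0 : ℝ) (1 / 2), 1 - 2 * u ∈ Set.Icc (0 : ℝ) 1 := fun u hu =>
    ⟨by linarith [hu.2], by linarith [hu.1]⟩
  have he : ∀ u : ℝ, binRenyi β u = curveEntropy β (biasCurve β (1 - 2 * u)) := fun u => by
    rw [← binRenyi_eq_curveEntropy]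
    congr 1
    ring
  rw [he, he] at hst
  have := biasCurve_injOn hβ (hmem s hs) (hmem t ht) (curveEntropy_injective_of_pos
    (fun h => biasCurve_pos h (hmem s hs)) (fun h => biasCurve_pos h (hmem t ht)) hst)
  linarith

theorem binRenyiInv_curveEntropy {β m : ℝ} (hβ : 0 < β) (hm : m ∈ Set.Icc (0 : ℝ) 1) :
    binRenyiInv β (curveEntropy β (biasCurve β m)) = (1 - m) / 2 := by
  rw [← binRenyi_eq_curveEntropy]
  exact (binRenyi_injOn hβ).leftInvOn_invFunOn
    ⟨by linarith [hm.2], by linarith [hm.1]⟩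

/-- The bound at entropies parametrized by biases: binary convolution multiplies biases. -/
theorem bscBound_curveEntropy {α m n : ℝ} (hα : 0 < α) (hm : m ∈ Set.Icc (0 : ℝ) 1)
    (hn : n ∈ Set.Icc (0 : ℝ) 1) :
    bscBound α (curveEntropy (1 / α) (biasCurve (1 / α) m))
      (curveEntropy (1 / α) (biasCurve (1 / α) n)) =
      curveEntropy (1 / α) (biasCurve (1 / α) m) + curveEntropy (1 / α) (biasCurve (1 / α) n) -
        curveEntropy (1 / α) (biasCurve (1 / α) (m * n)) := by
  have hβ := one_div_pos.2 hα
  rw [bscBound, binRenyiInv_curveEntropy hβ hm, binRenyiInv_curveEntropy hβ hn,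
    ← binRenyi_eq_curveEntropy _ (m * n)]
  congr 2
  rw [binConv]
  ring

/-- The upper and lower bounds on the entropy at the variable node. -/
theorem arimotoEntropy_variableNode_bounds {Y₁ Y₂ : Type*} [Fintype Y₁] [Fintype Y₂] {α : ℝ}
    (hα : 0 < α) {p₁ : ZMod 2 × Y₁ → ℝ} {p₂ : ZMod 2 × Y₂ → ℝ}
    (h₁ : p₁ ∈ stdSimplex ℝ (ZMod 2 × Y₁)) (h₂ : p₂ ∈ stdSimplex ℝ (ZMod 2 × Y₂)) :
    ((α ≤ 1 / 3 ∨ 1 / 2 ≤ α) → arimotoEntropy α (variableNode p₁ p₂) ≤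
      bscBound α (arimotoEntropy α p₁) (arimotoEntropy α p₂)) ∧
    ((1 / 3 ≤ α ∧ α ≤ 1 / 2) → bscBound α (arimotoEntropy α p₁) (arimotoEntropy α p₂) ≤
      arimotoEntropy α (variableNode p₁ p₂)) := by
  have hβ := one_div_pos.2 hα
  have hq := channelWeight_nonneg α h₁.1
  have hr := channelWeight_nonneg α h₂.1
  have hq1 := sum_channelWeight hα h₁
  have hr1 := sum_channelWeight hα h₂
  have hx := abs_channelBias_le_one α h₁.1
  have hy := abs_channelBias_le_one α h₂.1
  obtain ⟨m, hm, hmean⟩ := exists_biasCurve_eq_sum hβ hq hq1 hx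
  obtain ⟨n, hn, hnean⟩ := exists_biasCurve_eq_sum hβ hr hr1 hy
  obtain ⟨c1, c2, c3⟩ := sum_biasCurve_mul hβ hq hq1 hx hr hr1 hy hm hmean.symm hn hnean.symm
  have hmn : m * n ∈ Set.Icc (0 : ℝ) 1 :=
    ⟨mul_nonneg hm.1 hn.1, mul_le_one₀ hm.2 hn.1 hn.2⟩
  obtain ⟨k, hk, hkean⟩ := exists_biasCurve_eq_sum (ι := Y₁ × Y₂) hβ
    (q := fun w => channelWeight α p₁ w.1 * channelWeight α p₂ w.2)
    (x := fun w => channelBias α p₁ w.1 * channelBias α p₂ w.2)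
    (fun w => mul_nonneg (hq _) (hr _))
    (by rw [Fintype.sum_prod_type, ← Finset.sum_mul_sum, hq1, hr1, one_mul])
    (fun w => by rw [abs_mul]; exact mul_le_one₀ (hx _) (abs_nonneg _) (hy _))
  rw [Fintype.sum_prod_type] at hkean
  rw [arimotoEntropy_variableNode hα h₁ h₂, arimotoEntropy_eq_curveEntropy hα h₁,
    arimotoEntropy_eq_curveEntropy hα h₂, ← hmean, ← hnean, bscBound_curveEntropy hα hm hn]
  rw [← hkean] at c1 c2 c3 ⊢
  refine ⟨fun h => sub_le_sub_left ?_ _, fun h => sub_le_sub_left ?_ _⟩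
  · rcases le_or_gt 1 α with h1 | h1
    · have hβ1 : 1 / α ≤ 1 := (div_le_one hα).2 h1
      exact curveEntropy_le_of_le_one hβ1 (fun h => biasCurve_pos h hmn) (c1 hβ1)
    · have hβ1 : 1 < 1 / α := (one_lt_div hα).2 h1
      refine curveEntropy_le_of_one_lt hβ1 (biasCurve_pos hβ1.ne' hk) (c2 ?_)
      rcases h with h | h
      · exact Or.inr ((le_div_iff₀ hα).2 (by linarith))
      · exact Or.inl ⟨hβ1, (div_le_iff₀ hα).2 (by linarith)⟩
  · have hβ1 : 1 < 1 / α := (one_lt_div hα).2 (by linarith [h.2])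
    exact curveEntropy_le_of_one_lt hβ1 (biasCurve_pos hβ1.ne' hmn)
      (c3 ⟨(le_div_iff₀ hα).2 (by linarith [h.2]), (div_le_iff₀ hα).2 (by linarith [h.1])⟩)

/-! ### Binary symmetric channels -/

/-- The two outputs of a binary symmetric channel have opposite tilted biases. -/
theorem channelBias_bsc (α ε : ℝ) (y : ZMod 2) :
    channelBias α (bsc ε) y = channelBias α (bsc ε) 0 ∨
      channelBias α (bsc ε) y = -channelBias α (bsc ε) 0 := by
  have h : y = 0 ∨ y = 1 := by
    revert y
    decide
  rcases h with rfl | rfl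
  · exact Or.inl rfl
  · right
    rw [channelBias, channelBias, tiltedBias_comm]
    simp [bsc]

theorem arimotoEntropy_bsc {α ε : ℝ} (hα : 0 < α) (hε : ε ∈ Set.Icc (0 : ℝ) 1) :
    arimotoEntropy α (bsc ε) =
      curveEntropy (1 / α) (biasCurve (1 / α) |channelBias α (bsc ε) 0|) := by
  have hp := bsc_mem_stdSimplex hε
  rw [arimotoEntropy_eq_curveEntropy hα hp, biasCurve_abs]
  congr 1
  calc ∑ y, channelWeight α (bsc ε) y * biasCurve (1 / α) (channelBias α (bsc ε) y)
      = ∑ y, channelWeight α (bsc ε) y * biasCurve (1 / α) (channelBias α (bsc ε) 0) := by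
        refine Finset.sum_congr rfl fun y _ => ?_
        rcases channelBias_bsc α ε y with h | h <;> rw [h]
        rw [biasCurve_neg]
    _ = _ := by rw [← Finset.sum_mul, sum_channelWeight hα hp, one_mul]

theorem arimotoEntropy_variableNode_bsc {α ε₁ ε₂ : ℝ} (hα : 0 < α)
    (h₁ : ε₁ ∈ Set.Icc (0 : ℝ) 1) (h₂ : ε₂ ∈ Set.Icc (0 : ℝ) 1) :
    arimotoEntropy α (variableNode (bsc ε₁) (bsc ε₂)) =
      bscBound α (arimotoEntropy α (bsc ε₁)) (arimotoEntropy α (bsc ε₂)) := by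
  have hp₁ := bsc_mem_stdSimplex h₁
  have hp₂ := bsc_mem_stdSimplex h₂
  rw [arimotoEntropy_variableNode hα hp₁ hp₂, arimotoEntropy_bsc hα h₁, arimotoEntropy_bsc hα h₂,
    bscBound_curveEntropy hα ⟨abs_nonneg _, abs_channelBias_le_one α hp₁.1 0⟩
      ⟨abs_nonneg _, abs_channelBias_le_one α hp₂.1 0⟩, ← abs_mul, biasCurve_abs _ (_ * _)]
  congr 2
  set x := channelBias α (bsc ε₁) 0
  set y := channelBias α (bsc ε₂) 0
  have hconst : ∀ i j, biasCurve (1 / α)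
      (channelBias α (bsc ε₁) i * channelBias α (bsc ε₂) j) = biasCurve (1 / α) (x * y) := by
    intro i j
    rw [← biasCurve_abs, ← biasCurve_abs _ (x * y), abs_mul, abs_mul,
      abs_eq_abs.2 (channelBias_bsc α ε₁ i), abs_eq_abs.2 (channelBias_bsc α ε₂ j)]
  simp only [hconst, ← Finset.sum_mul]
  rw [← Finset.sum_mul_sum, sum_channelWeight hα hp₁, sum_channelWeight hα hp₂, one_mul, one_mul]

theorem tiltedBias_mul_left {α a b c : ℝ} (hc : 0 < c) (ha : 0 ≤ a) (hb : 0 ≤ b) :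
    tiltedBias α (c * a) (c * b) = tiltedBias α a b := by
  rw [tiltedBias, tiltedBias, Real.mul_rpow hc.le ha, Real.mul_rpow hc.le hb, ← mul_sub,
    ← mul_add, mul_div_mul_left _ _ (Real.rpow_pos_of_pos hc α).ne']

/-- Every bias in `[0, 1]` is the tilted bias of a binary symmetric channel. -/
theorem exists_channelBias_bsc_eq {α m : ℝ} (hα : 0 < α) (hm : m ∈ Set.Icc (0 : ℝ) 1) :
    ∃ ε ∈ Set.Icc (0 : ℝ) (1 / 2), channelBias α (bsc ε) 0 = m := by
  have hp : 0 < (1 + m) / 2 := by linarith [hm.1]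
  have hq : 0 ≤ (1 - m) / 2 := by linarith [hm.2]
  have hβ : 0 ≤ 1 / α := (one_div_pos.2 hα).le
  set a := ((1 + m) / 2) ^ (1 / α) with ha
  set b := ((1 - m) / 2) ^ (1 / α) with hb
  have ha0 : 0 < a := Real.rpow_pos_of_pos hp _
  have hb0 : 0 ≤ b := Real.rpow_nonneg hq _
  have hba : b ≤ a := Real.rpow_le_rpow hq (by linarith [hm.1]) hβ
  have hab : 0 < a + b := by linarith
  -- undo the tilting: the crossover distribution is proportional to the `1 / α` powers
  refine ⟨b / (a + b), ⟨by positivity, ?_⟩, ?_⟩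
  · rw [div_le_div_iff₀ hab two_pos]
    linarith
  · have e1 : 1 / 2 * (1 - b / (a + b)) = 1 / (2 * (a + b)) * a := by
      field_simp
      ring
    have e2 : 1 / 2 * (b / (a + b)) = 1 / (2 * (a + b)) * b := by field_simp
    have e3 : bsc (b / (a + b)) (0, 0) = 1 / (2 * (a + b)) * a := by
      rw [← e1]
      simp [bsc]
    have e4 : bsc (b / (a + b)) (1, 0) = 1 / (2 * (a + b)) * b := by
      rw [← e2]
      simp [bsc]
    rw [channelBias, e3, e4, tiltedBias_mul_left (by positivity) ha0.le hb0, tiltedBias, ha, hb,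
      one_div α, Real.rpow_inv_rpow hp.le hα.ne', Real.rpow_inv_rpow hq hα.ne']
    ring

/-- The entropy of a bit with bias in `[0, 1]` takes every value in `[0, log 2]`. -/
theorem exists_curveEntropy_eq {β H : ℝ} (hβ : 0 < β) (hH : H ∈ Set.Icc (0 : ℝ) (Real.log 2)) :
    ∃ m ∈ Set.Icc (0 : ℝ) 1, curveEntropy β (biasCurve β m) = H := by
  have hcont : ContinuousOn (fun m => curveEntropy β (biasCurve β m)) (Set.Icc 0 1) := by
    unfold curveEntropy
    split_ifs with h
    · exact (continuous_biasCurve hβ).continuousOn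
    · exact continuousOn_const.mul ((continuous_biasCurve hβ).continuousOn.log
        fun m hm => (biasCurve_pos h hm).ne')
  have h0 : curveEntropy β (biasCurve β 0) = Real.log 2 := by
    unfold curveEntropy biasCurve
    split_ifs with h
    · rw [sub_zero, one_div, Real.binEntropy_two_inv]
    · have h1 : 1 - β ≠ 0 := sub_ne_zero.2 (Ne.symm h)
      rw [add_zero, sub_zero, ← two_mul, one_div (2 : ℝ), Real.inv_rpow two_pos.le,
        Real.log_mul two_ne_zero (inv_ne_zero (Real.rpow_pos_of_pos two_pos β).ne'),
        Real.log_inv, Real.log_rpow two_pos]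
      field_simp
      ring
  have h1 : curveEntropy β (biasCurve β 1) = 0 := by
    unfold curveEntropy biasCurve
    split_ifs with h
    · simp
    · norm_num [Real.zero_rpow hβ.ne']
  have := intermediate_value_Icc' zero_le_one hcont
  rw [h0, h1] at this
  obtain ⟨m, hm, h⟩ := this hH
  exact ⟨m, hm, h⟩

theorem exists_arimotoEntropy_bsc_eq {α H : ℝ} (hα : 0 < α)
    (hH : H ∈ Set.Icc (0 : ℝ) (Real.log 2)) :
    ∃ ε ∈ Set.Icc (0 : ℝ) (1 / 2), arimotoEntropy α (bsc ε) = H := by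
  obtain ⟨m, hm, hmH⟩ := exists_curveEntropy_eq (one_div_pos.2 hα) hH
  obtain ⟨ε, hε, hεm⟩ := exists_channelBias_bsc_eq hα hm
  refine ⟨ε, hε, ?_⟩
  rw [arimotoEntropy_bsc hα ⟨hε.1, hε.2.trans (by norm_num)⟩, hεm, abs_of_nonneg hm.1, hmH]

end RenyiCombining

/-- Upper (respectively lower) bounds on `H^A_α(X₂ | X₁ + X₂, Y₁ Y₂)` by the value for binary
symmetric channels, for all bits `X₁, X₂` with finite side information, and their tightness. -/
theorem mainTheorem3 (α : ℝ) (hα : 0 < α) :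
    (∀ (Y₁ : Type*) (Y₂ : Type*) [Fintype Y₁] [Fintype Y₂]
      (p₁ : ZMod 2 × Y₁ → ℝ) (p₂ : ZMod 2 × Y₂ → ℝ),
      p₁ ∈ stdSimplex ℝ (ZMod 2 × Y₁) → p₂ ∈ stdSimplex ℝ (ZMod 2 × Y₂) →
      ((α ≤ 1 / 3 ∨ 1 / 2 ≤ α) →
        arimotoEntropy α (variableNode p₁ p₂) ≤
          bscBound α (arimotoEntropy α p₁) (arimotoEntropy α p₂)) ∧
      ((1 / 3 ≤ α ∧ α ≤ 1 / 2) →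
        bscBound α (arimotoEntropy α p₁) (arimotoEntropy α p₂) ≤
          arimotoEntropy α (variableNode p₁ p₂)) ∧
      ((α = 1 / 3 ∨ α = 1 / 2) →
        arimotoEntropy α (variableNode p₁ p₂) =
          bscBound α (arimotoEntropy α p₁) (arimotoEntropy α p₂))) ∧
    -- equality for all pairs of binary symmetric channels
    (∀ ε₁ ∈ Set.Icc (0 : ℝ) 1, ∀ ε₂ ∈ Set.Icc (0 : ℝ) 1,
      arimotoEntropy α (variableNode (bsc ε₁) (bsc ε₂)) =
        bscBound α (arimotoEntropy α (bsc ε₁)) (arimotoEntropy α (bsc ε₂))) ∧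
    -- hence the bound is attained at every pair of values of the two entropies
    (∀ H₁ ∈ Set.Icc (0 : ℝ) (Real.log 2), ∀ H₂ ∈ Set.Icc (0 : ℝ) (Real.log 2),
      ∃ ε₁ ∈ Set.Icc (0 : ℝ) (1 / 2), ∃ ε₂ ∈ Set.Icc (0 : ℝ) (1 / 2),
        arimotoEntropy α (bsc ε₁) = H₁ ∧ arimotoEntropy α (bsc ε₂) = H₂ ∧
        arimotoEntropy α (variableNode (bsc ε₁) (bsc ε₂)) = bscBound α H₁ H₂) := by
  refine ⟨fun Y₁ Y₂ _ _ p₁ p₂ h₁ h₂ => ?_, fun ε₁ h₁ ε₂ h₂ =>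
    arimotoEntropy_variableNode_bsc hα h₁ h₂, fun H₁ h₁ H₂ h₂ => ?_⟩
  · obtain ⟨hle, hge⟩ := arimotoEntropy_variableNode_bounds hα h₁ h₂
    -- at `α = 1 / 3` and `α = 1 / 2` both ranges apply
    refine ⟨hle, hge, fun h => le_antisymm (hle ?_) (hge ?_)⟩
    · exact h.imp le_of_eq ge_of_eq
    · rcases h with h | h <;> rw [h] <;> norm_num
  · obtain ⟨ε₁, hε₁, rfl⟩ := exists_arimotoEntropy_bsc_eq hα h₁
    obtain ⟨ε₂, hε₂, rfl⟩ := exists_arimotoEntropy_bsc_eq hα h₂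
    exact ⟨ε₁, hε₁, ε₂, hε₂, rfl, rfl, arimotoEntropy_variableNode_bsc hα
      ⟨hε₁.1, hε₁.2.trans (by norm_num)⟩ ⟨hε₂.1, hε₂.2.trans (by norm_num)⟩⟩
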